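/- **Setting.** Let $L/K$ be a cyclic Galois extension of fields of finite degree $n$, $\sigma$ a generator of $\mathrm{Gal}(L/K)$, and $R=L[x;\sigma]$ the skew polynomial ring, with $xa=a^{\sigma}x$ for $a\in L$. Let $K'\le K$ be a subfield with $[K:K']<\infty$, let $\rho\in\mathrm{Aut}(L/K')$ and $\eta\in L$. Let $F\in K[y]$ be monic and irreducible of degree $s$ with constant coefficient $F_0$, $F\neq y$, and put $R_F=R/RF(x^n)$. For an integer $k\ge 0$ put $$S_{n,s,k}(\eta,\rho,F)=\{a+RF(x^n):\ a\in R,\ \deg a\le sk,\ a_{sk}=\eta\,a_0^{\rho}\}\subseteq R_F ,$$ where $a_i$ is the coefficient of $x^i$ in $a$, and assume that $$N_{L:K'}(\eta)\,N_{K:K'}\big((-1)^{sk(n-1)}F_0^{k}\big)\neq 1 .$$ Fix a ring isomorphism $R_F\cong M_m(D)$ with $D$ a division ring, and regard $S_{n,s,k}(\eta,\rho,F)$ as a subset of $M_m(D)$. (If $K$ is finite, then $D\cong E_F:=K[y]/(F)$ and $m=n$.) For an additive subgroup $\mathcal C$ of $M_m(D)$ let $$\mathcal I_\ell(\mathcal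 C)=\{A: A\mathcal C\subseteq\mathcal C\},\qquad \mathcal I_r(\mathcal C)=\{A:\mathcal CA\subseteq\mathcal C\},$$ $$C(\mathcal C)=\{A: AX=XA\ \ \forall X\in\mathcal C\},\qquad Z(\mathcal C)=\mathcal I_\ell(\mathcal C)\cap C(\mathcal C),$$ with $A$ ranging over $M_m(D)$. A code $\mathcal C'\subseteq M_m(D)$ is equivalent to $\mathcal C$ if $\mathcal C'=\{AX^{\theta}B: X\in\mathcal C\}$ for some $A,B\in GL_m(D)$ and $\theta\in\mathrm{Aut}(D)$, where $\theta$ is applied entrywise. For an automorphism $\tau$ of $L$ let $L_\tau=\{a\in L:a^{\tau}=a\}$, and let $K_\rho=K\cap L_\rho$. Exponents compose from left to right, so that $L_{\sigma^{sk}\rho^{-1}}=\{a: (a^{\sigma^{sk}})^{\rho^{-1}}=a\}$. **Theorem.** Assume that $k\le n/2$ and $sk>1$, and let $\mathcal C'$ be any code that is equivalent to $S_{n,s,k}(\eta,\rho,F)$ and contains the identity. Then, with $\cong$ denoting isomorphism of rings: * If $\eta\ne 0$, then $\mathcal I_\ell(\mathcal C')\cong L_\rho$, $\ \mathcal I_r(\mathcal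 C')\cong L_{\sigma^{sk}\rho^{-1}}$, $\ C(\mathcal C')\cong Z(R_F)$ and $Z(\mathcal C')\cong K_\rho$. * If $\eta=0$, then $S_{n,s,k}(0,\rho,F)=S_{n,s,k}(0,\rho',F)$ for every additive map $\rho':L\to L$ in place of $\rho$ (in particular for $\rho'=0$), and $\mathcal I_\ell(\mathcal C')\cong L$, $\ \mathcal I_r(\mathcal C')\cong L$, $\ C(\mathcal C')\cong Z(R_F)$ and $Z(\mathcal C')\cong K$. -/

import Mathlib

open Polynomial

noncomputable section

namespace SkewCode

section SkewRing

variable {K L : Type*} [Field K] [Field L] [Algebra K L]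

/-- The action of `ℕ` on `L` by the iterates of `σ`; this is how Mathlib's skew polynomials
are told about the twist. -/
@[reducible] def twist (σ : L ≃ₐ[K] L) : MulSemiringAction (Multiplicative ℕ) L :=
  MulSemiringAction.compHom L (powersHom (L ≃ₐ[K] L) σ)

/-- The skew polynomial ring `L[x; σ]`: polynomials with coefficients on the left, multiplied
by the rule `x a = σ(a) x`. -/
def SkewPoly (_σ : L ≃ₐ[K] L) := SkewPolynomial L

instance (σ : L ≃ₐ[K] L) : Ring (SkewPoly σ) :=
  letI := twist σ
  inferInstanceAs (Ring (SkewPolynomial L))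

variable (σ : L ≃ₐ[K] L)

/-- The skew polynomial `a x ^ i`. -/
def SkewPoly.monomial (i : ℕ) (a : L) : SkewPoly σ := SkewPolynomial.monomial i a

variable {σ}

/-- The (left) coefficient of `x ^ i`. -/
def SkewPoly.coeff (f : SkewPoly σ) (i : ℕ) : L := SkewPolynomial.coeff f i

theorem SkewPoly.monomial_mul_monomial (i j : ℕ) (a b : L) :
    SkewPoly.monomial σ i a * SkewPoly.monomial σ j b =
      SkewPoly.monomial σ (i + j) (a * (σ ^ i) b) := by
  let := twist σ
  have h := SkewPolynomial.monomial_mul_monomial i j a b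
  rw [SkewPolynomial.φ_iterate_apply] at h
  exact h

theorem SkewPoly.coeff_zero (i : ℕ) : (0 : SkewPoly σ).coeff i = 0 := rfl

theorem SkewPoly.coeff_add (f g : SkewPoly σ) (i : ℕ) :
    (f + g).coeff i = f.coeff i + g.coeff i := by
  let := twist σ
  exact SkewPolynomial.coeff_add f g i

theorem SkewPoly.coeff_neg (f : SkewPoly σ) (i : ℕ) : (-f).coeff i = -f.coeff i := by
  have h := SkewPoly.coeff_add f (-f) i
  rw [add_neg_cancel, SkewPoly.coeff_zero] at h
  exact eq_neg_of_add_eq_zero_right h.symm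

variable (σ)

/-- The skew polynomial `F(x ^ n)` for `F ∈ K[y]`, where `n = [L : K]`. -/
def centralPoly (F : K[X]) : SkewPoly σ :=
  F.sum fun i c => SkewPoly.monomial σ (Module.finrank K L * i) (algebraMap K L c)

variable {σ} [FiniteDimensional K L] [IsGalois K L]

theorem pow_finrank_mul (i : ℕ) : σ ^ (Module.finrank K L * i) = 1 := by
  rw [← IsGalois.card_aut_eq_finrank, pow_mul, pow_card_eq_one', one_pow]

theorem centralPoly_comm (F : K[X]) (f : SkewPoly σ) :
    f * centralPoly σ F = centralPoly σ F * f := by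
  have key : ∀ (j : ℕ) (b : L), SkewPoly.monomial σ j b * centralPoly σ F =
      centralPoly σ F * SkewPoly.monomial σ j b := by
    intro j b
    simp only [centralPoly, Polynomial.sum_def, Finset.mul_sum, Finset.sum_mul,
      SkewPoly.monomial_mul_monomial, pow_finrank_mul, AlgEquiv.one_apply, AlgEquiv.commutes]
    exact Finset.sum_congr rfl fun i _ => by rw [add_comm j, mul_comm b]
  refine SkewPolynomial.induction (motive := fun f : SkewPoly σ =>
    f * centralPoly σ F = centralPoly σ F * f) f ?_ ?_
  · exact (zero_mul (centralPoly σ F)).trans (mul_zero _).symm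
  · intro j b q _ _ hq
    have h1 := add_mul (SkewPoly.monomial σ j b) q (centralPoly σ F)
    have h2 := mul_add (centralPoly σ F) (SkewPoly.monomial σ j b) q
    rw [key j b, hq] at h1
    exact h1.trans h2.symm

instance centralIdeal_isTwoSided (F : K[X]) :
    (Ideal.span {centralPoly σ F} : Ideal (SkewPoly σ)).IsTwoSided := by
  refine ⟨fun {a} b ha => ?_⟩
  obtain ⟨c, rfl⟩ := Ideal.mem_span_singleton'.1 ha
  refine Ideal.mem_span_singleton'.2 ⟨c * b, ?_⟩
  rw [mul_assoc, mul_assoc, centralPoly_comm]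

variable (σ)

/-- The ring `R_F = R / R F(x ^ n)`, where `R = L[x; σ]` and `n = [L : K]`. -/
abbrev SkewQuot (F : K[X]) := SkewPoly σ ⧸ (Ideal.span {centralPoly σ F} : Ideal (SkewPoly σ))

/-- The code `S_{n,s,k}(η, ρ, F) = {a + R F(x ^ n) : deg a ≤ s k, a_{sk} = η a_0 ^ ρ}`, where
`s = deg F`. -/
def code (F : K[X]) (k : ℕ) (η : L) (ρ : L →+ L) : AddSubgroup (SkewQuot σ F) where
  carrier := {c | ∃ a : SkewPoly σ, (∀ i, F.natDegree * k < i → a.coeff i = 0) ∧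
    a.coeff (F.natDegree * k) = η * ρ (a.coeff 0) ∧ Ideal.Quotient.mk _ a = c}
  zero_mem' := ⟨0, fun _ _ => rfl, by simp [SkewPoly.coeff_zero], map_zero _⟩
  add_mem' := by
    rintro _ _ ⟨a, ha, ha', rfl⟩ ⟨b, hb, hb', rfl⟩
    refine ⟨a + b, fun i hi => ?_, ?_, map_add _ _ _⟩
    · rw [SkewPoly.coeff_add, ha i hi, hb i hi, add_zero]
    · rw [SkewPoly.coeff_add, SkewPoly.coeff_add, ha', hb', map_add, mul_add]
  neg_mem' := by
    rintro _ ⟨a, ha, ha', rfl⟩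
    refine ⟨-a, fun i hi => ?_, ?_, map_neg _ _⟩
    · rw [SkewPoly.coeff_neg, ha i hi, neg_zero]
    · rw [SkewPoly.coeff_neg, SkewPoly.coeff_neg, ha', map_neg, mul_neg]

/-- The subfield `L_τ` of elements fixed by the automorphism `τ` of `L`. -/
def fixedSubfield (τ : L ≃+* L) : Subfield L := RingHom.eqLocusField (τ : L →+* L) (RingHom.id L)

end SkewRing

section Codes

/-- Two additive codes of `m × m` matrices over `D` are equivalent if the second is
`{A X ^ θ B : X ∈ C}` for some invertible `A`, `B` and some automorphism `θ` of `D`, applied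
entrywise. -/
def Equivalent {D : Type*} [DivisionRing D] {m : ℕ}
    (C C' : AddSubgroup (Matrix (Fin m) (Fin m) D)) : Prop :=
  ∃ (A B : (Matrix (Fin m) (Fin m) D)ˣ) (θ : D ≃+* D),
    (C' : Set (Matrix (Fin m) (Fin m) D)) =
      {Y | ∃ X ∈ C, Y = (A : Matrix (Fin m) (Fin m) D) * X.map θ * B}

variable {M : Type*} [Ring M]

/-- `{A : A C ⊆ C}`. -/
def leftIdealiser (C : AddSubgroup M) : Subring M where
  carrier := {A | ∀ X ∈ C, A * X ∈ C}
  mul_mem' := fun {A B} hA hB X hX => by rw [mul_assoc]; exact hA _ (hB X hX)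
  one_mem' := fun X hX => by rwa [one_mul]
  add_mem' := fun {A B} hA hB X hX => by rw [add_mul]; exact C.add_mem (hA X hX) (hB X hX)
  zero_mem' := fun X _ => by rw [zero_mul]; exact C.zero_mem
  neg_mem' := fun {A} hA X hX => by rw [neg_mul]; exact C.neg_mem (hA X hX)

/-- `{A : C A ⊆ C}`. -/
def rightIdealiser (C : AddSubgroup M) : Subring M where
  carrier := {A | ∀ X ∈ C, X * A ∈ C}
  mul_mem' := fun {A B} hA hB X hX => by rw [← mul_assoc]; exact hB _ (hA X hX)
  one_mem' := fun X hX => by rwa [mul_one]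
  add_mem' := fun {A B} hA hB X hX => by rw [mul_add]; exact C.add_mem (hA X hX) (hB X hX)
  zero_mem' := fun X _ => by rw [mul_zero]; exact C.zero_mem
  neg_mem' := fun {A} hA X hX => by rw [mul_neg]; exact C.neg_mem (hA X hX)

/-- `{A : A X = X A for all X ∈ C}`. -/
def centraliser (C : AddSubgroup M) : Subring M := Subring.centralizer (C : Set M)

/-- The centre of a code: the intersection of its left idealiser and its centraliser. -/
def centre (C : AddSubgroup M) : Subring M := leftIdealiser C ⊓ centraliser C

end Codes

end SkewCode

end

/-!
Write `S` for the code, `d = s k` and `N = n s`, so that `2 d ≤ N`; `x` is a unit of `R_F` because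
`F_0 ≠ 0`.

Left idealiser. Let `A S ⊆ S`. As `x ∈ S`, the element `A x` has a representative `b` of degree at
most `d`. As `β x ^ (d - 1) ∈ S` for all `β`, the product `b β x ^ (d - 2)` also satisfies the
conditions defining `S`; its degree shows that `b` has degree at most `2`, and its coefficient of
`x ^ d` that `b_2 β ^ (σ ^ 2) = η (b β x ^ (d - 2))_0 ^ ρ`. Finally `1 + η x ^ d ∈ S`, so
`A (1 + η x ^ d) x = e x` with `e` of degree at most `d`. Written in terms of `b`, this puts a skew
polynomial of degree at most `N` into the ideal; it is a constant multiple of `F(x ^ n)`, which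
expresses `b_0` through `b_{N - d}`. So `b_0 = 0` unless `d = 2` and `N = 4`. Then `b_0` satisfies
`u = F_0 η η ^ σ u ^ (σ ^ 2)`, which after `n / 2 = k` iterations becomes
`u = N_{L:K}(η) F_0 ^ k u`, and the norm condition gives `b_0 = 0`. Hence `b = b_1 x` and
`A = b_1`. A constant `a` lies in the left idealiser exactly when `a η = η a ^ ρ`. The right
idealiser is treated in the same way with `x A`.

Centraliser. It is enough to study pairs with `c X = X c'` for all `X ∈ S`, a condition that is
stable under equivalence. The elements `β x ∈ S` show that `c` commutes with `L` and that
`c x = x c'`; if `c = c'` then `c` is central. For `d ≥ 3` this follows from `x ^ 2 ∈ S`. For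
`d = 2` the element `1 + η x ^ 2` gives `δ = η x δ x` for `δ = c - c'`. Pulling constants through
both sides yields `δ = 0` if `σ ^ 2 ≠ 1`; otherwise `n = s = 2` and `x δ = - δ x`, so
`(1 + η x ^ 2) δ = 0`, and one of `1 + η x ^ 2` (if `η ∈ K`) and `(η - η ^ σ) x ^ 2` is a unit
that annihilates `δ`.
-/

noncomputable section

namespace SkewCode

section SkewPolynomials

variable {K L : Type*} [Field K] [Field L] [Algebra K L] {σ : L ≃ₐ[K] L}

namespace SkewPoly

@[ext] theorem ext {f g : SkewPoly σ} (h : ∀ i, f.coeff i = g.coeff i) : f = g :=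
  SkewPolynomial.ext h

theorem coeff_sub (f g : SkewPoly σ) (i : ℕ) : (f - g).coeff i = f.coeff i - g.coeff i := by
  rw [sub_eq_add_neg, coeff_add, coeff_neg, sub_eq_add_neg]

theorem coeff_monomial (i j : ℕ) (a : L) :
    (monomial σ i a).coeff j = if i = j then a else 0 :=
  SkewPolynomial.coeff_monomial

theorem monomial_zero_right (i : ℕ) : monomial σ i 0 = 0 := by
  ext j
  rw [coeff_monomial, coeff_zero, ite_self]

theorem eq_monomial_of_coeff_eq_zero {f : SkewPoly σ} {i : ℕ} (h : ∀ j, j ≠ i → f.coeff j = 0) :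
    f = monomial σ i (f.coeff i) := by
  ext j
  rw [coeff_monomial]
  split_ifs with hij
  · rw [hij]
  · exact h j (Ne.symm hij)

theorem monomial_add (i : ℕ) (a b : L) :
    monomial σ i (a + b) = monomial σ i a + monomial σ i b := by
  ext j
  simp only [coeff_add, coeff_monomial]
  split_ifs <;> simp only [add_zero]

variable (σ) in
/-- The embedding of `L` into `L[x; σ]` as the constant skew polynomials. -/
def C : L →+* SkewPoly σ where
  toFun := monomial σ 0
  map_one' := rfl
  map_mul' a b := by simp only [monomial_mul_monomial, add_zero, pow_zero, AlgEquiv.one_apply]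
  map_zero' := monomial_zero_right 0
  map_add' := monomial_add 0

theorem coeff_C (a : L) (i : ℕ) : (C σ a).coeff i = if 0 = i then a else 0 :=
  coeff_monomial 0 i a

theorem C_mul_monomial (i : ℕ) (a b : L) : C σ a * monomial σ i b = monomial σ i (a * b) :=
  (monomial_mul_monomial 0 i a b).trans (by rw [zero_add, pow_zero, AlgEquiv.one_apply])

theorem monomial_mul_C (i : ℕ) (a b : L) :
    monomial σ i a * C σ b = monomial σ i (a * (σ ^ i) b) :=
  monomial_mul_monomial i 0 a b

theorem monomial_one_pow (i j : ℕ) : monomial σ i 1 ^ j = monomial σ (i * j) 1 := by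
  induction j with
  | zero => rfl
  | succ j ih => rw [pow_succ, ih, monomial_mul_monomial, map_one, mul_one, Nat.mul_succ]

theorem induction_on {P : SkewPoly σ → Prop} (f : SkewPoly σ) (zero : P 0)
    (monomial_add : ∀ i a g, P g → P (monomial σ i a + g)) : P f :=
  SkewPolynomial.induction (motive := P) f zero fun i a g _ _ hg => monomial_add i a g hg

theorem coeff_monomial_mul (f : SkewPoly σ) (j : ℕ) (b : L) (i : ℕ) :
    (monomial σ j b * f).coeff i = if j ≤ i then b * (σ ^ j) (f.coeff (i - j)) else 0 := by
  induction f using induction_on with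
  | zero => simp only [mul_zero, coeff_zero, map_zero, ite_self]
  | monomial_add l a g hg =>
    rw [mul_add, coeff_add, hg, monomial_mul_monomial, coeff_monomial, coeff_add, coeff_monomial]
    have hij : j + l = i ↔ j ≤ i ∧ l = i - j := by omega
    simp only [hij]
    by_cases hj : j ≤ i <;> by_cases hl : l = i - j <;> simp [hj, hl, mul_add]

theorem coeff_mul (f g : SkewPoly σ) (m : ℕ) :
    (f * g).coeff m = ∑ i ∈ Finset.range (m + 1), f.coeff i * (σ ^ i) (g.coeff (m - i)) := by
  induction f using induction_on with
  | zero => simp only [zero_mul, coeff_zero, Finset.sum_const_zero]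
  | monomial_add l a f hf =>
    simp only [add_mul, coeff_add, hf, coeff_monomial_mul, coeff_monomial, Finset.sum_add_distrib,
      ite_mul, zero_mul, Finset.sum_ite_eq, Finset.mem_range, Order.lt_add_one_iff]

theorem coeff_mul_monomial (f : SkewPoly σ) (j : ℕ) (b : L) (i : ℕ) :
    (f * monomial σ j b).coeff i = if j ≤ i then f.coeff (i - j) * (σ ^ (i - j)) b else 0 := by
  induction f using induction_on with
  | zero => simp only [zero_mul, coeff_zero, ite_self]
  | monomial_add l a g hg =>
    rw [add_mul, coeff_add, hg, monomial_mul_monomial, coeff_monomial, coeff_add, coeff_monomial]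
    have hij : l + j = i ↔ j ≤ i ∧ l = i - j := by omega
    simp only [hij]
    by_cases hj : j ≤ i <;> by_cases hl : l = i - j <;> simp [hj, hl, add_mul]

theorem coeff_C_mul (a : L) (f : SkewPoly σ) (i : ℕ) : (C σ a * f).coeff i = a * f.coeff i := by
  refine (coeff_monomial_mul f 0 a i).trans ?_
  rw [if_pos i.zero_le, Nat.sub_zero, pow_zero, AlgEquiv.one_apply]

theorem coeff_mul_C (f : SkewPoly σ) (a : L) (i : ℕ) :
    (f * C σ a).coeff i = f.coeff i * (σ ^ i) a := by
  refine (coeff_mul_monomial f 0 a i).trans ?_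
  rw [if_pos i.zero_le, Nat.sub_zero]

theorem coeff_mul_of_degree_le {f g : SkewPoly σ} {a b : ℕ} (hf : ∀ i, a < i → f.coeff i = 0)
    (hg : ∀ i, b < i → g.coeff i = 0) :
    (f * g).coeff (a + b) = f.coeff a * (σ ^ a) (g.coeff b) := by
  rw [coeff_mul, Finset.sum_eq_single a, Nat.add_sub_cancel_left]
  · intro i _ hia
    rcases lt_or_gt_of_ne hia with h | h
    · rw [hg _ (by omega), map_zero, mul_zero]
    · rw [hf i h, zero_mul]
  · simp

theorem exists_leadingCoeff {f : SkewPoly σ} (hf : f ≠ 0) :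
    ∃ d, f.coeff d ≠ 0 ∧ ∀ i, d < i → f.coeff i = 0 := by
  have hne : (SkewPolynomial.support f).Nonempty :=
    Finset.nonempty_iff_ne_empty.2 fun h => hf (SkewPolynomial.support_eq_empty.1 h)
  refine ⟨_, SkewPolynomial.mem_support_iff.1 (Finset.max'_mem _ hne), fun i hi => ?_⟩
  by_contra hfi
  exact hi.not_ge (Finset.le_max' _ _ (SkewPolynomial.mem_support_iff.2 hfi))

theorem coeff_centralPoly (F : K[X]) (m : ℕ) : (centralPoly σ F).coeff m =
    ∑ i ∈ F.support, if Module.finrank K L * i = m then algebraMap K L (F.coeff i) else 0 := by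
  let coeffHom : SkewPoly σ →+ L := ⟨⟨fun f => f.coeff m, coeff_zero m⟩, fun f g => coeff_add f g m⟩
  rw [centralPoly, Polynomial.sum_def]
  exact (map_sum coeffHom _ _).trans (Finset.sum_congr rfl fun i _ => coeff_monomial (σ := σ) _ _ _)

variable (σ) in
/-- The substitution `P ↦ P(x ^ n)`, where `n = [L : K]`, as a ring homomorphism from `K[y]` to
`L[x; σ]`. -/
def centralHom : K[X] →+* SkewPoly σ :=
  Polynomial.eval₂RingHom' ((C σ).comp (algebraMap K L)) (monomial σ (Module.finrank K L) 1)
    fun a => by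
      change C σ (algebraMap K L a) * _ = _ * C σ (algebraMap K L a)
      rw [C_mul_monomial, monomial_mul_C, AlgEquiv.commutes, mul_comm]

theorem centralHom_apply (P : K[X]) : centralHom σ P = centralPoly σ P := by
  change P.eval₂ ((C σ).comp (algebraMap K L)) _ = _
  simp only [Polynomial.eval₂_eq_sum, monomial_one_pow, RingHom.comp_apply, C_mul_monomial, mul_one,
    centralPoly]

theorem coeff_centralPoly_of_lt (F : K[X]) {m : ℕ} (hm : Module.finrank K L * F.natDegree < m) :
    (centralPoly σ F).coeff m = 0 := by
  rw [coeff_centralPoly]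
  refine Finset.sum_eq_zero fun i hi => if_neg ?_
  have := Nat.mul_le_mul_left (Module.finrank K L) (Polynomial.le_natDegree_of_mem_supp i hi)
  omega

variable [FiniteDimensional K L]

theorem coeff_centralPoly_finrank_mul (F : K[X]) (i : ℕ) :
    (centralPoly σ F).coeff (Module.finrank K L * i) = algebraMap K L (F.coeff i) := by
  have hn : 0 < Module.finrank K L := Module.finrank_pos
  simp only [coeff_centralPoly, mul_right_inj' hn.ne', Finset.sum_ite_eq']
  split_ifs with h
  · rfl
  · rw [Polynomial.notMem_support_iff.1 h, map_zero]

theorem eq_C_mul_centralPoly_of_mem_span {F : K[X]} (hF : F.Monic) {p : SkewPoly σ}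
    (hp : p ∈ Ideal.span {centralPoly σ F})
    (hdeg : ∀ i, Module.finrank K L * F.natDegree < i → p.coeff i = 0) :
    p = C σ (p.coeff (Module.finrank K L * F.natDegree)) * centralPoly σ F := by
  obtain ⟨g, rfl⟩ := Ideal.mem_span_singleton'.1 hp
  rcases eq_or_ne g 0 with rfl | hg
  · simp only [zero_mul, coeff_zero, map_zero]
  obtain ⟨d, hd, hgd⟩ := exists_leadingCoeff hg
  have htop : (g * centralPoly σ F).coeff (d + Module.finrank K L * F.natDegree) = g.coeff d := by
    rw [coeff_mul_of_degree_le hgd fun i => coeff_centralPoly_of_lt F,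
      coeff_centralPoly_finrank_mul, Polynomial.coeff_natDegree, hF.leadingCoeff, map_one, map_one,
      mul_one]
  obtain rfl : d = 0 := by
    by_contra hd0
    exact hd (htop.symm.trans (hdeg _ (by omega)))
  have hgC : g = C σ (g.coeff 0) :=
    eq_monomial_of_coeff_eq_zero fun j hj => hgd j (Nat.pos_of_ne_zero hj)
  rw [zero_add] at htop
  rw [htop, ← hgC]

theorem eq_zero_of_mem_span {F : K[X]} (hF : F.Monic) {p : SkewPoly σ}
    (hp : p ∈ Ideal.span {centralPoly σ F})
    (hdeg : ∀ i, Module.finrank K L * F.natDegree ≤ i → p.coeff i = 0) : p = 0 := by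
  rw [eq_C_mul_centralPoly_of_mem_span hF hp fun i hi => hdeg i hi.le, hdeg _ le_rfl, map_zero,
    zero_mul]

theorem coeff_zero_of_mem_span {F : K[X]} (hF : F.Monic) {p : SkewPoly σ}
    (hp : p ∈ Ideal.span {centralPoly σ F})
    (hdeg : ∀ i, Module.finrank K L * F.natDegree < i → p.coeff i = 0) :
    p.coeff 0 =
      p.coeff (Module.finrank K L * F.natDegree) * algebraMap K L (F.coeff 0) := by
  have h0 := coeff_centralPoly_finrank_mul (σ := σ) F 0
  rw [mul_zero] at h0
  conv_lhs => rw [eq_C_mul_centralPoly_of_mem_span hF hp hdeg, coeff_C_mul, h0]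

end SkewPoly

end SkewPolynomials

section Quotient

variable {K L : Type*} [Field K] [Field L] [Algebra K L] [FiniteDimensional K L] [IsGalois K L]
  {σ : L ≃ₐ[K] L} {F : K[X]}

theorem mem_range_algebraMap_of_apply_eq (hσ : ∀ τ : L ≃ₐ[K] L, τ ∈ Subgroup.zpowers σ) {a : L}
    (ha : σ a = a) : a ∈ (algebraMap K L).range :=
  (IsGalois.mem_range_algebraMap_iff_fixed a).2 fun τ =>
    (Subgroup.zpowers_le (H := MulAction.stabilizer (L ≃ₐ[K] L) a)).2 ha (hσ τ)

namespace SkewPoly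

variable (σ F)

/-- The projection of `L[x; σ]` onto `R_F`. -/
abbrev mk : SkewPoly σ →+* SkewQuot σ F := Ideal.Quotient.mk _

/-- The map from `L` to `R_F`, the constants of `R_F`. -/
def const : L →+* SkewQuot σ F := (mk σ F).comp (C σ)

/-- The class of `x` in `R_F`. -/
def root : SkewQuot σ F := mk σ F (monomial σ 1 1)

/-- The class of `P(x ^ n)` in `R_F`, for `P ∈ K[y]`. -/
def ofCentral : K[X] →+* SkewQuot σ F := (mk σ F).comp (centralHom σ)

variable {σ F}

theorem mk_monomial (i : ℕ) (a : L) : mk σ F (monomial σ i a) = const σ F a * root σ F ^ i := by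
  rw [root, ← map_pow, monomial_one_pow, one_mul]
  exact (congrArg _ (by rw [C_mul_monomial, mul_one])).trans (map_mul (mk σ F) (C σ a) _)

theorem mk_C_add_monomial (a b : L) (i : ℕ) :
    mk σ F (C σ a + monomial σ i b) = const σ F a + const σ F b * root σ F ^ i := by
  rw [map_add, mk_monomial]
  rfl

theorem root_pow_mul_const (i : ℕ) (a : L) :
    root σ F ^ i * const σ F a = const σ F ((σ ^ i) a) * root σ F ^ i := by
  have h : monomial σ i 1 * C σ a = C σ ((σ ^ i) a) * monomial σ i 1 := by
    rw [monomial_mul_C, C_mul_monomial, one_mul, mul_one]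
  have h' := congrArg (mk σ F) h
  rw [map_mul, map_mul, mk_monomial, map_one, one_mul] at h'
  exact h'

theorem root_mul_const (a : L) : root σ F * const σ F a = const σ F (σ a) * root σ F := by
  simpa only [pow_one] using root_pow_mul_const 1 a

theorem ofCentral_commute (P : K[X]) (c : SkewQuot σ F) : Commute (ofCentral σ F P) c := by
  obtain ⟨f, rfl⟩ := Ideal.Quotient.mk_surjective c
  change mk σ F _ * mk σ F f = mk σ F f * mk σ F _
  rw [← map_mul, ← map_mul, centralHom_apply, centralPoly_comm]

theorem ofCentral_self : ofCentral σ F F = 0 :=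
  Ideal.Quotient.eq_zero_iff_mem.2 (by
    rw [centralHom_apply]
    exact Ideal.mem_span_singleton_self _)

theorem ofCentral_C (a : K) : ofCentral σ F (Polynomial.C a) = const σ F (algebraMap K L a) :=
  congrArg (mk σ F) (Polynomial.eval₂_C _ _)

theorem ofCentral_X : ofCentral σ F X = root σ F ^ Module.finrank K L := by
  refine (congrArg (mk σ F) (Polynomial.eval₂_X _ _)).trans ?_
  rw [mk_monomial, map_one, one_mul]

theorem isUnit_ofCentral {P : K[X]} (hP : IsCoprime P F) : IsUnit (ofCentral σ F P) := by
  obtain ⟨u, v, h⟩ := hP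
  have h1 : ofCentral σ F u * ofCentral σ F P = 1 := by
    rw [← map_one (ofCentral σ F), ← h, map_add, map_mul, map_mul, ofCentral_self, mul_zero,
      add_zero]
  exact isUnit_iff_exists.2 ⟨_, (ofCentral_commute P _).eq.trans h1, h1⟩

theorem isUnit_root (hF0 : F.coeff 0 ≠ 0) : IsUnit (root σ F) := by
  have hX : IsCoprime X F :=
    (Polynomial.irreducible_X.coprime_iff_not_dvd).2 (mt Polynomial.X_dvd_iff.1 hF0)
  rw [← isUnit_pow_iff (Module.finrank_pos (R := K) (M := L)).ne', ← ofCentral_X]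
  exact isUnit_ofCentral hX

omit [IsGalois K L] in
theorem nontrivial_skewQuot (hF : F.Monic) (hF1 : 0 < F.natDegree) : Nontrivial (SkewQuot σ F) := by
  refine Ideal.Quotient.nontrivial_iff.2 fun h => ?_
  have hpos : 0 < Module.finrank K L * F.natDegree := Nat.mul_pos Module.finrank_pos hF1
  have h1 : C σ 1 = 0 := eq_zero_of_mem_span hF (h ▸ Submodule.mem_top) fun i hi => by
    rw [coeff_C, if_neg (by omega)]
  simpa only [coeff_C, if_true, coeff_zero, one_ne_zero] using congrArg (coeff · 0) h1

theorem mem_center_of_commute {c : SkewQuot σ F} (hconst : ∀ a, Commute c (const σ F a))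
    (hroot : Commute c (root σ F)) : c ∈ Subring.center (SkewQuot σ F) := by
  refine Subring.mem_center_iff.2 fun g => ?_
  obtain ⟨f, rfl⟩ := Ideal.Quotient.mk_surjective g
  induction f using induction_on with
  | zero => rw [map_zero, zero_mul, mul_zero]
  | monomial_add i a g hg =>
    rw [map_add, add_mul, mul_add, hg, mk_monomial, ((hconst a).mul_right (hroot.pow_right i)).eq]

theorem const_mem_center_iff [Nontrivial (SkewQuot σ F)]
    (hσ : ∀ τ : L ≃ₐ[K] L, τ ∈ Subgroup.zpowers σ) (hF0 : F.coeff 0 ≠ 0) {a : L} :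
    const σ F a ∈ Subring.center (SkewQuot σ F) ↔ a ∈ (algebraMap K L).range := by
  constructor
  · intro h
    have hσa : σ a = a := (const σ F).injective <| (isUnit_root hF0).mul_right_cancel <| by
      rw [← root_mul_const, Subring.mem_center_iff.1 h]
    exact mem_range_algebraMap_of_apply_eq hσ hσa
  · rintro ⟨b, rfl⟩
    rw [← ofCentral_C]
    exact Subring.mem_center_iff.2 fun c => (ofCentral_commute _ c).eq.symm

section Code

variable {k d : ℕ} {η : L} {ρ : L →+ L}

theorem mk_mem_code_iff (hF : F.Monic) (hd : F.natDegree * k = d)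
    (hdN : d < Module.finrank K L * F.natDegree) {p : SkewPoly σ}
    (hp : ∀ i, Module.finrank K L * F.natDegree ≤ i → p.coeff i = 0) :
    mk σ F p ∈ code σ F k η ρ ↔
      (∀ i, d < i → p.coeff i = 0) ∧ p.coeff d = η * ρ (p.coeff 0) := by
  subst hd
  constructor
  · rintro ⟨a, ha, ha', hap⟩
    have hdiff : a - p = 0 := eq_zero_of_mem_span hF (Ideal.Quotient.eq.1 hap) fun i hi => by
      rw [coeff_sub, hp i hi, ha i (by omega), sub_zero]
    rw [← sub_eq_zero.1 hdiff]
    exact ⟨ha, ha'⟩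
  · rintro ⟨h, h'⟩
    exact ⟨p, h, h', rfl⟩

theorem mk_monomial_mem_code (hd : F.natDegree * k = d) {i : ℕ} (hi : 0 < i) (hid : i < d)
    (a : L) : mk σ F (monomial σ i a) ∈ code σ F k η ρ := by
  subst hd
  refine ⟨_, fun j hj => ?_, ?_, rfl⟩
  · rw [coeff_monomial, if_neg (by omega)]
  · rw [coeff_monomial, coeff_monomial, if_neg hid.ne, if_neg hi.ne', map_zero, mul_zero]

theorem mk_C_add_monomial_mem_code (hd : F.natDegree * k = d) (hd0 : 0 < d) (a : L) :
    mk σ F (C σ a + monomial σ d (η * ρ a)) ∈ code σ F k η ρ := by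
  subst hd
  refine ⟨_, fun j hj => ?_, ?_, rfl⟩
  · rw [coeff_add, coeff_C, coeff_monomial, if_neg (by omega), if_neg (by omega), add_zero]
  · simp only [coeff_add, coeff_C, coeff_monomial, if_true, if_neg hd0.ne, if_neg hd0.ne',
      zero_add, add_zero]

end Code

end SkewPoly

end Quotient

section Norm

variable {K L : Type*} [Field K] [Field L] [Algebra K L] [FiniteDimensional K L] [IsGalois K L]
  {σ : L ≃ₐ[K] L}

theorem algebraMap_norm_eq_prod_range (hσ : ∀ τ : L ≃ₐ[K] L, τ ∈ Subgroup.zpowers σ) (a : L) :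
    algebraMap K L (Algebra.norm K a) =
      ∏ i ∈ Finset.range (Module.finrank K L), (σ ^ i) a := by
  classical
  rw [Algebra.norm_eq_prod_automorphisms, ← IsGalois.card_aut_eq_finrank,
    ← IsCyclic.image_range_card hσ, Finset.prod_image]
  rw [← orderOf_eq_card_of_forall_mem_zpowers hσ, Finset.coe_range]
  exact pow_injOn_Iio_orderOf

theorem eq_zero_of_eq_mul_apply_apply (hσ : ∀ τ : L ≃ₐ[K] L, τ ∈ Subgroup.zpowers σ) {k : ℕ}
    (hn : Module.finrank K L = 2 * k) {a : K} {η u : L} (hη : Algebra.norm K η * a ^ k ≠ 1)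
    (hu : u = algebraMap K L a * (η * σ η) * σ (σ u)) : u = 0 := by
  have iterate (j : ℕ) : u =
      algebraMap K L (a ^ j) * (∏ i ∈ Finset.range (2 * j), (σ ^ i) η) * (σ ^ (2 * j)) u := by
    induction j with
    | zero => simp
    | succ j ih =>
      have hu' := congrArg (σ ^ (2 * j)) hu
      simp only [map_mul, AlgEquiv.commutes, ← AlgEquiv.mul_apply, ← pow_succ, ← mul_assoc] at hu'
      rw [hu'] at ih
      rw [Nat.mul_succ, Finset.prod_range_succ, Finset.prod_range_succ, pow_succ a, map_mul]
      linear_combination ih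
  have hk : (σ ^ (2 * k)) u = u := by
    rw [← hn, ← mul_one (Module.finrank K L), pow_finrank_mul, AlgEquiv.one_apply]
  have hfix := iterate k
  rw [hk, ← hn, ← algebraMap_norm_eq_prod_range hσ, ← map_mul] at hfix
  by_contra hu0
  refine hη ((algebraMap K L).injective ?_)
  rw [map_one, mul_comm]
  exact mul_right_cancel₀ hu0 (by rw [one_mul, ← hfix])

end Norm

theorem eq_mul_apply_of_forall_mul_apply_eq {L : Type*} [Field L] {τ ρ : L →+* L} {η u w : L}
    (h : ∀ β, w * τ β = η * ρ (u * β)) : w = η * τ u := by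
  have hw : w = η * ρ u := by simpa only [map_one, mul_one] using h 1
  rcases eq_or_ne w 0 with rfl | hw0
  · rcases mul_eq_zero.1 hw.symm with rfl | hu
    · rw [zero_mul]
    · rw [(map_eq_zero ρ).1 hu, map_zero, mul_zero]
  · have hτρ : τ u = ρ u := mul_left_cancel₀ hw0 <| by
      rw [h, map_mul, hw, mul_assoc]
    rw [hτρ, hw]

section Idealisers

variable {K L : Type*} [Field K] [Field L] [Algebra K L] [FiniteDimensional K L] [IsGalois K L]
  {σ : L ≃ₐ[K] L} {F : K[X]} {k d : ℕ} {η : L}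

namespace SkewPoly

theorem exists_mk_eq_mul_root {ρ : L →+ L} (hF : F.Monic) (hd : F.natDegree * k = d) (hd2 : 2 ≤ d)
    (hdN : 2 * d ≤ Module.finrank K L * F.natDegree) {A : SkewQuot σ F}
    (hA : A ∈ leftIdealiser (code σ F k η ρ)) :
    ∃ b : SkewPoly σ, mk σ F b = A * root σ F ∧ (∀ i, 2 < i → b.coeff i = 0) ∧
      ∀ β, b.coeff 2 * (σ ^ 2) β = η * ρ ((b * monomial σ (d - 2) β).coeff 0) := by
  obtain ⟨b, hbd, -, hb⟩ := hA _ (mk_monomial_mem_code hd one_pos hd2 1)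
  rw [hd] at hbd
  have hmem (β : L) : (∀ i, d < i → (b * monomial σ (d - 2) β).coeff i = 0) ∧
      (b * monomial σ (d - 2) β).coeff d = η * ρ ((b * monomial σ (d - 2) β).coeff 0) := by
    refine (mk_mem_code_iff hF hd (by omega) fun i hi => ?_).1 ?_
    · rw [coeff_mul_monomial, if_pos (by omega), hbd _ (by omega), zero_mul]
    · rw [map_mul, hb, mul_assoc, ← map_mul, monomial_mul_monomial]
      exact hA _ (mk_monomial_mem_code hd (by omega) (by omega) _)
  refine ⟨b, hb, fun i hi => ?_, fun β => ?_⟩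
  · have h := (hmem 1).1 (i + (d - 2)) (by omega)
    rwa [coeff_mul_monomial, if_pos (by omega), Nat.add_sub_cancel, map_one, mul_one] at h
  · have h := (hmem β).2
    rwa [coeff_mul_monomial, if_pos (by omega), Nat.sub_sub_self hd2] at h

theorem coeff_zero_eq_of_mk_eq_mul_root {ρ : L →+ L} (hF : F.Monic) (hd : F.natDegree * k = d)
    (hd2 : 2 ≤ d) (hdN : 2 * d ≤ Module.finrank K L * F.natDegree) {A : SkewQuot σ F}
    (hA : A ∈ leftIdealiser (code σ F k η ρ)) {b : SkewPoly σ} (hb : mk σ F b = A * root σ F)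
    (hb2 : ∀ i, 2 < i → b.coeff i = 0) :
    b.coeff 0 = algebraMap K L (F.coeff 0) *
      (b.coeff (Module.finrank K L * F.natDegree - d) *
        (σ ^ (Module.finrank K L * F.natDegree - d)) (σ.symm (η * ρ 1))) := by
  obtain ⟨e, hed, -, he⟩ := hA _ (mk_C_add_monomial_mem_code hd (by omega) 1)
  rw [hd] at hed
  set p := b + b * monomial σ d (σ.symm (η * ρ 1)) - e * monomial σ 1 1 with hp
  have hmem : p ∈ Ideal.span {centralPoly σ F} := by
    refine Ideal.Quotient.eq_zero_iff_mem.1 ?_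
    have hcomm : root σ F * mk σ F (monomial σ d (σ.symm (η * ρ 1))) =
        mk σ F (monomial σ d (η * ρ 1)) * root σ F := by
      rw [mk_monomial, mk_monomial, ← mul_assoc, root_mul_const, AlgEquiv.apply_symm_apply,
        mul_assoc, mul_assoc, ← pow_succ', ← pow_succ]
    change mk σ F p = 0
    rw [hp, map_sub, map_add, map_mul (mk σ F), map_mul (mk σ F), hb, he, mul_assoc A, hcomm,
      map_add, map_one (C σ), map_one (mk σ F), ← root]
    noncomm_ring
  have h := coeff_zero_of_mem_span hF hmem fun i hi => by
    rw [hp, coeff_sub, coeff_add, coeff_mul_monomial, coeff_mul_monomial, if_pos (by omega),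
      if_pos (by omega), hb2 i (by omega), hb2 _ (by omega), hed _ (by omega)]
    simp only [zero_mul, add_zero, sub_zero]
  rw [hp, coeff_sub, coeff_sub, coeff_add, coeff_add] at h
  simp only [coeff_mul_monomial] at h
  rw [if_neg (by omega), if_neg (by omega), if_pos (by omega), if_pos (by omega),
    hb2 _ (by omega : 2 < Module.finrank K L * F.natDegree), hed _ (by omega)] at h
  linear_combination h

omit [FiniteDimensional K L] [IsGalois K L] in
theorem finrank_eq_two_mul (hd : F.natDegree * k = d) (hd0 : d ≠ 0)
    (h : Module.finrank K L * F.natDegree = 2 * d) : Module.finrank K L = 2 * k := by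
  have hs : 0 < F.natDegree := Nat.pos_of_ne_zero fun h0 => hd0 (by rw [← hd, h0, zero_mul])
  refine Nat.eq_of_mul_eq_mul_right hs (h.trans ?_)
  rw [← hd, mul_assoc, mul_comm k]

theorem exists_eq_const_of_mem_leftIdealiser (hσ : ∀ τ : L ≃ₐ[K] L, τ ∈ Subgroup.zpowers σ)
    {ρ : L →+* L} (hF : F.Monic) (hF0 : F.coeff 0 ≠ 0) (hd : F.natDegree * k = d) (hd2 : 2 ≤ d)
    (hdN : 2 * d ≤ Module.finrank K L * F.natDegree)
    (hη : d = 2 → Module.finrank K L = 2 * k → Algebra.norm K η * F.coeff 0 ^ k ≠ 1)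
    {A : SkewQuot σ F} (hA : A ∈ leftIdealiser (code σ F k η (ρ : L →+ L))) :
    ∃ a, A = const σ F a := by
  obtain ⟨b, hb, hb2, hcode⟩ := exists_mk_eq_mul_root hF hd hd2 hdN hA
  have hideal := coeff_zero_eq_of_mk_eq_mul_root hF hd hd2 hdN hA hb hb2
  have hb0 : b.coeff 0 = 0 := by
    by_cases hN : 2 < Module.finrank K L * F.natDegree - d
    · rw [hideal, hb2 _ hN, zero_mul, mul_zero]
    obtain rfl : d = 2 := by omega
    have hn : Module.finrank K L = 2 * k := finrank_eq_two_mul hd two_ne_zero (by omega)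
    have hb2' : b.coeff 2 = η * (σ ^ 2) (b.coeff 0) := by
      refine eq_mul_apply_of_forall_mul_apply_eq (τ := ((σ ^ 2 : L ≃ₐ[K] L) : L →+* L)) (ρ := ρ)
        fun β => (hcode β).trans ?_
      simp [coeff_mul_monomial]
    refine eq_zero_of_eq_mul_apply_apply hσ hn (hη rfl hn) ?_
    rw [show Module.finrank K L * F.natDegree - 2 = 2 by omega, hb2'] at hideal
    simp only [AddMonoidHom.coe_coe, map_one, mul_one, pow_two, AlgEquiv.mul_apply,
      AlgEquiv.apply_symm_apply] at hideal
    linear_combination hideal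
  have hb2' : b.coeff 2 = 0 := by
    simpa [coeff_mul_monomial, hb0] using hcode 1
  have hbx : b = monomial σ 1 (b.coeff 1) := by
    refine eq_monomial_of_coeff_eq_zero fun i hi => ?_
    rcases (by omega : i = 0 ∨ i = 2 ∨ 2 < i) with rfl | rfl | hi2
    exacts [hb0, hb2', hb2 i hi2]
  refine ⟨b.coeff 1, (isUnit_root hF0).mul_right_cancel ?_⟩
  rw [← hb, ← pow_one (root σ F), ← mk_monomial, ← hbx]

theorem exists_mk_eq_root_mul {ρ : L →+ L} (hF : F.Monic) (hd : F.natDegree * k = d) (hd2 : 2 ≤ d)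
    (hdN : 2 * d ≤ Module.finrank K L * F.natDegree) {A : SkewQuot σ F}
    (hA : A ∈ rightIdealiser (code σ F k η ρ)) :
    ∃ b : SkewPoly σ, mk σ F b = root σ F * A ∧ (∀ i, 2 < i → b.coeff i = 0) ∧
      ∀ β, β * (σ ^ (d - 2)) (b.coeff 2) = η * ρ ((monomial σ (d - 2) β * b).coeff 0) := by
  obtain ⟨b, hbd, -, hb⟩ := hA _ (mk_monomial_mem_code hd one_pos hd2 1)
  rw [hd] at hbd
  have hmem (β : L) : (∀ i, d < i → (monomial σ (d - 2) β * b).coeff i = 0) ∧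
      (monomial σ (d - 2) β * b).coeff d = η * ρ ((monomial σ (d - 2) β * b).coeff 0) := by
    refine (mk_mem_code_iff hF hd (by omega) fun i hi => ?_).1 ?_
    · rw [coeff_monomial_mul, if_pos (by omega), hbd _ (by omega), map_zero, mul_zero]
    · rw [map_mul, hb, ← mul_assoc, ← map_mul, monomial_mul_monomial]
      exact hA _ (mk_monomial_mem_code hd (by omega) (by omega) _)
  refine ⟨b, hb, fun i hi => ?_, fun β => ?_⟩
  · have h := (hmem 1).1 (i + (d - 2)) (by omega)
    rwa [coeff_monomial_mul, if_pos (by omega), Nat.add_sub_cancel, one_mul, map_eq_zero] at h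
  · have h := (hmem β).2
    rwa [coeff_monomial_mul, if_pos (by omega), Nat.sub_sub_self hd2] at h

theorem coeff_zero_eq_of_mk_eq_root_mul {ρ : L →+ L} (hF : F.Monic) (hd : F.natDegree * k = d)
    (hd2 : 2 ≤ d) (hdN : 2 * d ≤ Module.finrank K L * F.natDegree) {A : SkewQuot σ F}
    (hA : A ∈ rightIdealiser (code σ F k η ρ)) {b : SkewPoly σ} (hb : mk σ F b = root σ F * A)
    (hb2 : ∀ i, 2 < i → b.coeff i = 0) :
    b.coeff 0 = algebraMap K L (F.coeff 0) *
      (σ (η * ρ 1) * (σ ^ d) (b.coeff (Module.finrank K L * F.natDegree - d))) := by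
  obtain ⟨e, hed, -, he⟩ := hA _ (mk_C_add_monomial_mem_code hd (by omega) 1)
  rw [hd] at hed
  set p := b + monomial σ d (σ (η * ρ 1)) * b - monomial σ 1 1 * e with hp
  have hmem : p ∈ Ideal.span {centralPoly σ F} := by
    refine Ideal.Quotient.eq_zero_iff_mem.1 ?_
    have hcomm : mk σ F (monomial σ d (σ (η * ρ 1))) * root σ F =
        root σ F * mk σ F (monomial σ d (η * ρ 1)) := by
      rw [mk_monomial, mk_monomial, ← mul_assoc, root_mul_const, mul_assoc, mul_assoc, ← pow_succ',
        ← pow_succ]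
    change mk σ F p = 0
    rw [hp, map_sub, map_add, map_mul (mk σ F), map_mul (mk σ F), hb, he, ← mul_assoc _ _ A, hcomm,
      map_add, map_one (C σ), map_one (mk σ F), ← root]
    noncomm_ring
  have h := coeff_zero_of_mem_span hF hmem fun i hi => by
    rw [hp, coeff_sub, coeff_add, coeff_monomial_mul, coeff_monomial_mul, if_pos (by omega),
      if_pos (by omega), hb2 i (by omega), hb2 _ (by omega), hed _ (by omega)]
    simp only [map_zero, mul_zero, add_zero, sub_zero]
  rw [hp, coeff_sub, coeff_sub, coeff_add, coeff_add] at h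
  simp only [coeff_monomial_mul] at h
  rw [if_neg (by omega), if_neg (by omega), if_pos (by omega), if_pos (by omega),
    hb2 _ (by omega : 2 < Module.finrank K L * F.natDegree), hed _ (by omega), map_zero] at h
  linear_combination h

theorem exists_eq_const_of_mem_rightIdealiser (hσ : ∀ τ : L ≃ₐ[K] L, τ ∈ Subgroup.zpowers σ)
    {ρ : L →+* L} (hF : F.Monic) (hF0 : F.coeff 0 ≠ 0) (hd : F.natDegree * k = d) (hd2 : 2 ≤ d)
    (hdN : 2 * d ≤ Module.finrank K L * F.natDegree)
    (hη : d = 2 → Module.finrank K L = 2 * k → Algebra.norm K η * F.coeff 0 ^ k ≠ 1)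
    {A : SkewQuot σ F} (hA : A ∈ rightIdealiser (code σ F k η (ρ : L →+ L))) :
    ∃ a, A = const σ F a := by
  obtain ⟨b, hb, hb2, hcode⟩ := exists_mk_eq_root_mul hF hd hd2 hdN hA
  have hideal := coeff_zero_eq_of_mk_eq_root_mul hF hd hd2 hdN hA hb hb2
  have hb0 : b.coeff 0 = 0 := by
    by_cases hN : 2 < Module.finrank K L * F.natDegree - d
    · rw [hideal, hb2 _ hN, map_zero, mul_zero, mul_zero]
    obtain rfl : d = 2 := by omega
    have hn : Module.finrank K L = 2 * k := finrank_eq_two_mul hd two_ne_zero (by omega)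
    have hb2' : b.coeff 2 = η * b.coeff 0 := by
      refine eq_mul_apply_of_forall_mul_apply_eq (τ := RingHom.id L) (ρ := ρ)
        (u := b.coeff 0) fun β => ?_
      have h := hcode β
      simp only [coeff_monomial_mul] at h
      simpa [mul_comm] using h
    have hnorm : Algebra.norm K (σ η) = Algebra.norm K η := Algebra.norm_eq_of_algEquiv σ η
    refine eq_zero_of_eq_mul_apply_apply (η := σ η) hσ hn (hnorm ▸ hη rfl hn) ?_
    rw [show Module.finrank K L * F.natDegree - 2 = 2 by omega, hb2'] at hideal
    simp only [AddMonoidHom.coe_coe, map_one, mul_one, map_mul, pow_two,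
      AlgEquiv.mul_apply] at hideal
    linear_combination hideal
  have hb2' : b.coeff 2 = 0 := by
    rw [← map_eq_zero (σ ^ (d - 2))]
    simpa [coeff_monomial_mul, hb0] using hcode 1
  have hbx : b = monomial σ 1 (b.coeff 1) := by
    refine eq_monomial_of_coeff_eq_zero fun i hi => ?_
    rcases (by omega : i = 0 ∨ i = 2 ∨ 2 < i) with rfl | rfl | hi2
    exacts [hb0, hb2', hb2 i hi2]
  refine ⟨σ.symm (b.coeff 1), (isUnit_root hF0).mul_left_cancel ?_⟩
  rw [← hb, root_mul_const, AlgEquiv.apply_symm_apply, ← pow_one (root σ F), ← mk_monomial, ← hbx]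

end SkewPoly

end Idealisers

section Intertwiners

variable {K L : Type*} [Field K] [Field L] [Algebra K L] [FiniteDimensional K L] [IsGalois K L]
  {σ : L ≃ₐ[K] L} {F : K[X]} {k d : ℕ} {η : L}

namespace SkewPoly

theorem eq_zero_of_eq_mul_root_mul_root_of_ne {δ : SkewQuot σ F}
    (hconst : ∀ a, Commute δ (const σ F a)) (hδ : δ = const σ F η * (root σ F * δ * root σ F))
    {a : L} (ha : σ (σ a) ≠ a) : δ = 0 := by
  have hpull : root σ F * δ * root σ F * const σ F a =
      const σ F (σ (σ a)) * (root σ F * δ * root σ F) := by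
    rw [mul_assoc, root_mul_const, ← mul_assoc, mul_assoc (root σ F), (hconst _).eq, ← mul_assoc,
      root_mul_const]
    simp only [mul_assoc]
  have hcomm : const σ F a * δ = const σ F (σ (σ a)) * δ := by
    rw [← (hconst a).eq]
    nth_rw 1 [hδ]
    rw [mul_assoc, hpull, ← mul_assoc, ← map_mul, mul_comm, map_mul, mul_assoc, ← hδ]
  have hunit : IsUnit (const σ F (a - σ (σ a))) :=
    (IsUnit.mk0 _ (sub_ne_zero.2 ha.symm)).map (const σ F)
  rw [← hunit.mul_right_eq_zero, map_sub, sub_mul, hcomm, sub_self]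

theorem eq_zero_of_one_add_mul_root_sq_mul (hσ : ∀ τ : L ≃ₐ[K] L, τ ∈ Subgroup.zpowers σ)
    (hFi : Irreducible F) (hF0 : F.coeff 0 ≠ 0) (hF1 : 1 < F.natDegree)
    (hn : Module.finrank K L = 2) {δ : SkewQuot σ F} (hanti : root σ F * δ = -(δ * root σ F))
    (hδ : (1 + const σ F η * root σ F ^ 2) * δ = 0) : δ = 0 := by
  have hx := isUnit_root (σ := σ) hF0
  have hσδ : (1 + const σ F (σ η) * root σ F ^ 2) * δ = 0 := by
    rw [← (hx.neg).mul_left_eq_zero, mul_neg, mul_assoc, ← mul_neg, ← hanti, ← mul_assoc]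
    have hswap : (1 + const σ F (σ η) * root σ F ^ 2) * root σ F =
        root σ F * (1 + const σ F η * root σ F ^ 2) := by
      rw [add_mul, mul_add, ← mul_assoc, root_mul_const, mul_assoc, mul_assoc, ← pow_succ,
        ← pow_succ', one_mul, mul_one]
    rw [hswap, mul_assoc, hδ, mul_zero]
  by_cases hη : σ η = η
  · obtain ⟨e, rfl⟩ := mem_range_algebraMap_of_apply_eq hσ hη
    have hcop : IsCoprime (1 + Polynomial.C e * X) F := by
      refine ((hFi.coprime_iff_not_dvd).2 fun h => ?_).symm
      have hne : (1 + Polynomial.C e * X : K[X]) ≠ 0 := fun h0 => by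
        simpa using congrArg (Polynomial.coeff · 0) h0
      have hle : (1 + Polynomial.C e * X : K[X]).natDegree ≤ 1 := by compute_degree
      exact absurd (Polynomial.natDegree_le_of_dvd h hne) (by omega)
    have hunit := isUnit_ofCentral (σ := σ) hcop
    rw [map_add, map_one, map_mul, ofCentral_C, ofCentral_X, hn] at hunit
    exact hunit.mul_right_eq_zero.1 hδ
  · have hunit : IsUnit (const σ F (η - σ η) * root σ F ^ 2) :=
      ((IsUnit.mk0 _ (sub_ne_zero.2 (Ne.symm hη))).map (const σ F)).mul (hx.pow 2)
    rw [← hunit.mul_right_eq_zero, map_sub, sub_mul, ← add_sub_add_left_eq_sub _ _ 1, sub_mul, hδ,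
      hσδ, sub_zero]

theorem finrank_eq_two_of_apply_apply_eq (hσ : ∀ τ : L ≃ₐ[K] L, τ ∈ Subgroup.zpowers σ)
    (hd : F.natDegree * k = 2) (hN : 4 ≤ Module.finrank K L * F.natDegree)
    (h : ∀ a, σ (σ a) = a) : Module.finrank K L = 2 ∧ F.natDegree = 2 := by
  have hn : Module.finrank K L ∣ 2 := by
    rw [← IsGalois.card_aut_eq_finrank, ← orderOf_eq_card_of_forall_mem_zpowers hσ]
    exact orderOf_dvd_of_pow_eq_one (AlgEquiv.ext fun a => by
      rw [pow_two, AlgEquiv.mul_apply, h, AlgEquiv.one_apply])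
  have hn2 := Nat.le_of_dvd two_pos hn
  have hs2 := Nat.le_of_dvd two_pos (Dvd.intro k hd)
  constructor <;> nlinarith

theorem commute_const_of_mul_root_eq_root_mul (hF0 : F.coeff 0 ≠ 0) {c c' : SkewQuot σ F}
    (h : ∀ a, c * (const σ F a * root σ F) = const σ F a * root σ F * c') (a : L) :
    Commute c (const σ F a) ∧ Commute c' (const σ F a) := by
  have hroot : c * root σ F = root σ F * c' := by simpa only [map_one, one_mul] using h 1
  have hc (a : L) : Commute c (const σ F a) := (isUnit_root hF0).mul_right_cancel <| by
    rw [mul_assoc, h, mul_assoc, mul_assoc, hroot]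
  refine ⟨hc a, (isUnit_root hF0).mul_left_cancel ?_⟩
  rw [← mul_assoc, ← hroot, mul_assoc, root_mul_const, ← mul_assoc, (hc _).eq, mul_assoc, hroot,
    ← mul_assoc, ← root_mul_const, mul_assoc]

theorem eq_of_mul_one_add_root_sq (hσ : ∀ τ : L ≃ₐ[K] L, τ ∈ Subgroup.zpowers σ)
    (hFi : Irreducible F) (hF0 : F.coeff 0 ≠ 0) (hd : F.natDegree * k = 2)
    (hN : 4 ≤ Module.finrank K L * F.natDegree) {c c' : SkewQuot σ F}
    (hroot : ∀ a, c * (const σ F a * root σ F) = const σ F a * root σ F * c')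
    (hsq : c * (1 + const σ F η * root σ F ^ 2) = (1 + const σ F η * root σ F ^ 2) * c') :
    c = c' := by
  have hx : c * root σ F = root σ F * c' := by simpa only [map_one, one_mul] using hroot 1
  have hconst := commute_const_of_mul_root_eq_root_mul hF0 hroot
  have hδ : c - c' = const σ F η * (root σ F * (c - c') * root σ F) := by
    have h1 : root σ F * c * root σ F = root σ F ^ 2 * c' := by
      rw [mul_assoc, hx, pow_two, mul_assoc]
    have h2 : root σ F * c' * root σ F = c * root σ F ^ 2 := by rw [← hx, pow_two, mul_assoc]
    rw [mul_sub, sub_mul, h1, h2, mul_sub, ← mul_assoc, ← mul_assoc _ c, ← (hconst η).1.eq,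
      mul_assoc c]
    rw [mul_add, add_mul, mul_one, one_mul] at hsq
    exact sub_eq_sub_iff_add_eq_add.2 (hsq.trans (add_comm _ _))
  refine sub_eq_zero.1 ?_
  by_cases hσ2 : ∀ a, σ (σ a) = a
  · obtain ⟨hn, hs⟩ := finrank_eq_two_of_apply_apply_eq hσ hd hN hσ2
    have hsq_comm (b : SkewQuot σ F) : Commute (root σ F ^ 2) b := by
      rw [← hn, ← ofCentral_X]
      exact ofCentral_commute X b
    have hx' : c' * root σ F = root σ F * c := (isUnit_root hF0).mul_left_cancel <| by
      rw [← mul_assoc, ← hx, mul_assoc, ← pow_two, ← (hsq_comm c).eq, pow_two, mul_assoc]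
    have hanti : root σ F * (c - c') = -((c - c') * root σ F) := by
      rw [mul_sub, sub_mul, hx, hx', neg_sub]
    refine eq_zero_of_one_add_mul_root_sq_mul (η := η) hσ hFi hF0 (by omega) hn hanti ?_
    rw [add_mul, one_mul]
    nth_rw 1 [hδ]
    rw [hanti, neg_mul, mul_assoc (c - c'), ← pow_two, ← (hsq_comm (c - c')).eq,
      mul_neg, mul_assoc, neg_add_cancel]
  · push Not at hσ2
    obtain ⟨a, ha⟩ := hσ2
    exact eq_zero_of_eq_mul_root_mul_root_of_ne (fun b => (hconst b).1.sub_left (hconst b).2) hδ ha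

theorem mem_center_of_forall_mem_code (hσ : ∀ τ : L ≃ₐ[K] L, τ ∈ Subgroup.zpowers σ)
    (hFi : Irreducible F) (hF0 : F.coeff 0 ≠ 0) {ρ : L →+ L} (hd : F.natDegree * k = d)
    (hd2 : 2 ≤ d) (hdN : 2 * d ≤ Module.finrank K L * F.natDegree) {c c' : SkewQuot σ F}
    (h : ∀ X ∈ code σ F k η ρ, c * X = X * c') : c ∈ Subring.center (SkewQuot σ F) := by
  have hpow {i : ℕ} (hi : 0 < i) (hid : i < d) (a : L) :
      c * (const σ F a * root σ F ^ i) = const σ F a * root σ F ^ i * c' := by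
    rw [← mk_monomial]
    exact h _ (mk_monomial_mem_code hd hi hid a)
  have hroot (a : L) : c * (const σ F a * root σ F) = const σ F a * root σ F * c' := by
    simpa only [pow_one] using hpow one_pos hd2 a
  have hx : c * root σ F = root σ F * c' := by simpa only [map_one, one_mul] using hroot 1
  have hcc' : c = c' := by
    rcases hd2.eq_or_lt with rfl | hd3
    · refine eq_of_mul_one_add_root_sq (η := η * ρ 1) hσ hFi hF0 hd hdN hroot ?_
      have h1 := h _ (mk_C_add_monomial_mem_code hd two_pos 1)
      rwa [mk_C_add_monomial, map_one (const σ F)] at h1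
    · have hsq : c * root σ F ^ 2 = root σ F ^ 2 * c' := by
        simpa only [map_one, one_mul] using hpow two_pos hd3 1
      refine (isUnit_root hF0).mul_left_cancel ((isUnit_root hF0).mul_right_cancel ?_)
      rw [mul_assoc, hx, ← mul_assoc, ← pow_two, ← hsq, pow_two, ← mul_assoc, hx]
  exact mem_center_of_commute (fun a => (commute_const_of_mul_root_eq_root_mul hF0 hroot a).1)
    (hx.trans (by rw [hcc']))

end SkewPoly

end Intertwiners

section Idealisers

variable {K L : Type*} [Field K] [Field L] [Algebra K L] [FiniteDimensional K L] [IsGalois K L]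
  {σ : L ≃ₐ[K] L} {F : K[X]} {k d : ℕ} {η : L} {ρ : L →+* L}

namespace SkewPoly

theorem const_mem_leftIdealiser_iff (hF : F.Monic) (hd : F.natDegree * k = d) (hd0 : 0 < d)
    (hdN : d < Module.finrank K L * F.natDegree) {b : L} :
    const σ F b ∈ leftIdealiser (code σ F k η (ρ : L →+ L)) ↔ b * η = η * ρ b := by
  constructor
  · intro h
    have hmem := h _ (mk_C_add_monomial_mem_code hd hd0 1)
    change mk σ F (C σ b) * mk σ F _ ∈ _ at hmem
    rw [← map_mul, mk_mem_code_iff hF hd hdN fun i hi => by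
      rw [coeff_C_mul, coeff_add, coeff_C, coeff_monomial, if_neg (by omega), if_neg (by omega),
        add_zero, mul_zero]] at hmem
    have h0 := hmem.2
    simpa only [coeff_C_mul, coeff_add, coeff_C, coeff_monomial, if_true, if_neg hd0.ne,
      if_neg hd0.ne', zero_add, add_zero, mul_one, AddMonoidHom.coe_coe, map_one ρ] using h0
  · rintro hb _ ⟨a, ha, ha0, rfl⟩
    refine ⟨C σ b * a, fun i hi => ?_, ?_, map_mul _ _ _⟩
    · rw [coeff_C_mul, ha i hi, mul_zero]
    · rw [coeff_C_mul, coeff_C_mul, ha0]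
      rw [AddMonoidHom.coe_coe, map_mul, ← mul_assoc, hb, mul_assoc]

theorem const_mem_rightIdealiser_iff (hF : F.Monic) (hd : F.natDegree * k = d) (hd0 : 0 < d)
    (hdN : d < Module.finrank K L * F.natDegree) {b : L} :
    const σ F b ∈ rightIdealiser (code σ F k η (ρ : L →+ L)) ↔ η * (σ ^ d) b = η * ρ b := by
  constructor
  · intro h
    have hmem := h _ (mk_C_add_monomial_mem_code hd hd0 1)
    change mk σ F _ * mk σ F (C σ b) ∈ _ at hmem
    rw [← map_mul, mk_mem_code_iff hF hd hdN fun i hi => by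
      rw [coeff_mul_C, coeff_add, coeff_C, coeff_monomial, if_neg (by omega), if_neg (by omega),
        add_zero, zero_mul]] at hmem
    have h0 := hmem.2
    simpa only [coeff_mul_C, coeff_add, coeff_C, coeff_monomial, if_true, if_neg hd0.ne,
      if_neg hd0.ne', zero_add, add_zero, mul_one, one_mul, pow_zero, AlgEquiv.one_apply,
      AddMonoidHom.coe_coe, map_one ρ] using h0
  · rintro hb _ ⟨a, ha, ha0, rfl⟩
    refine ⟨a * C σ b, fun i hi => ?_, ?_, map_mul _ _ _⟩
    · rw [coeff_mul_C, ha i hi, zero_mul]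
    · rw [coeff_mul_C, coeff_mul_C, ha0, hd]
      rw [AddMonoidHom.coe_coe, map_mul, pow_zero, AlgEquiv.one_apply, mul_right_comm, hb]
      ring

theorem leftIdealiser_code_eq_map (hσ : ∀ τ : L ≃ₐ[K] L, τ ∈ Subgroup.zpowers σ)
    (hF : F.Monic) (hF0 : F.coeff 0 ≠ 0) (hd : F.natDegree * k = d) (hd2 : 2 ≤ d)
    (hdN : 2 * d ≤ Module.finrank K L * F.natDegree)
    (hη : d = 2 → Module.finrank K L = 2 * k → Algebra.norm K η * F.coeff 0 ^ k ≠ 1)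
    {U : Subring L} (hU : ∀ b, b ∈ U ↔ b * η = η * ρ b) :
    leftIdealiser (code σ F k η (ρ : L →+ L)) = U.map (const σ F) := by
  have hconst {b : L} := const_mem_leftIdealiser_iff (σ := σ) (η := η) (ρ := ρ) (b := b) hF hd
    (by omega) (by omega)
  ext A
  rw [Subring.mem_map]
  constructor
  · intro hA
    obtain ⟨b, rfl⟩ := exists_eq_const_of_mem_leftIdealiser hσ hF hF0 hd hd2 hdN hη hA
    exact ⟨b, (hU b).2 (hconst.1 hA), rfl⟩
  · rintro ⟨b, hb, rfl⟩
    exact hconst.2 ((hU b).1 hb)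

theorem rightIdealiser_code_eq_map (hσ : ∀ τ : L ≃ₐ[K] L, τ ∈ Subgroup.zpowers σ)
    (hF : F.Monic) (hF0 : F.coeff 0 ≠ 0) (hd : F.natDegree * k = d) (hd2 : 2 ≤ d)
    (hdN : 2 * d ≤ Module.finrank K L * F.natDegree)
    (hη : d = 2 → Module.finrank K L = 2 * k → Algebra.norm K η * F.coeff 0 ^ k ≠ 1)
    {V : Subring L} (hV : ∀ b, b ∈ V ↔ η * (σ ^ d) b = η * ρ b) :
    rightIdealiser (code σ F k η (ρ : L →+ L)) = V.map (const σ F) := by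
  have hconst {b : L} := const_mem_rightIdealiser_iff (σ := σ) (η := η) (ρ := ρ) (b := b) hF hd
    (by omega) (by omega)
  ext A
  rw [Subring.mem_map]
  constructor
  · intro hA
    obtain ⟨b, rfl⟩ := exists_eq_const_of_mem_rightIdealiser hσ hF hF0 hd hd2 hdN hη hA
    exact ⟨b, (hV b).2 (hconst.1 hA), rfl⟩
  · rintro ⟨b, hb, rfl⟩
    exact hconst.2 ((hV b).1 hb)

theorem map_const_inf_center [Nontrivial (SkewQuot σ F)]
    (hσ : ∀ τ : L ≃ₐ[K] L, τ ∈ Subgroup.zpowers σ) (hF0 : F.coeff 0 ≠ 0) (U : Subring L) :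
    U.map (const σ F) ⊓ Subring.center (SkewQuot σ F) =
      (U.comap (algebraMap K L)).map ((const σ F).comp (algebraMap K L)) := by
  ext A
  constructor
  · rintro ⟨⟨b, hb, rfl⟩, hcenter⟩
    obtain ⟨a, rfl⟩ := (const_mem_center_iff hσ hF0).1 hcenter
    exact ⟨a, hb, rfl⟩
  · rintro ⟨a, ha, rfl⟩
    exact ⟨⟨_, ha, rfl⟩, (const_mem_center_iff hσ hF0).2 ⟨a, rfl⟩⟩

end SkewPoly

end Idealisers

section Transfer

variable {R M : Type*} [Ring R] [Ring M]

/-- Conjugation by a unit, as a ring automorphism. -/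
def unitConj (A : Mˣ) : M ≃+* M :=
  MulSemiringAction.toRingEquiv (ConjAct Mˣ) M (ConjAct.toConjAct A)

theorem unitConj_apply (A : Mˣ) (y : M) : unitConj A y = A * y * ↑A⁻¹ := by
  rw [unitConj, MulSemiringAction.toRingEquiv_apply_apply, ConjAct.units_smul_def,
    ConjAct.ofConjAct_toConjAct]

theorem nonempty_ringEquiv_of_eq_map {f : R →+* M} (hf : Function.Injective f) {U : Subring R}
    {V : Subring M} (h : V = U.map f) : Nonempty (V ≃+* U) :=
  ⟨(RingEquiv.subringCongr h).trans (U.equivMapOfInjective f hf).symm⟩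

variable {S : AddSubgroup R} {C' : AddSubgroup M} {ψ : R ≃+* M} {U : Mˣ}

theorem leftIdealiser_eq_map (hC : ∀ X, ψ X * U ∈ C' ↔ X ∈ S) :
    leftIdealiser C' = (leftIdealiser S).map (ψ : R →+* M) := by
  have hmem (a X : R) : ψ a * (ψ X * U) ∈ C' ↔ a * X ∈ S := by rw [← hC, map_mul, mul_assoc]
  ext y
  obtain ⟨a, rfl⟩ := ψ.surjective y
  rw [Subring.mem_map_equiv, ψ.symm_apply_apply]
  constructor
  · exact fun h X hX => (hmem a X).1 (h _ ((hC X).2 hX))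
  · intro h Y hY
    obtain ⟨Y, rfl⟩ := U.mulRight.surjective Y
    obtain ⟨X, rfl⟩ := ψ.surjective Y
    exact (hmem a X).2 (h X ((hC X).1 hY))

theorem rightIdealiser_eq_map (hC : ∀ X, ψ X * U ∈ C' ↔ X ∈ S) :
    rightIdealiser C' = (rightIdealiser S).map (ψ.trans (unitConj U⁻¹) : R →+* M) := by
  have hmem (a X : R) : ψ X * U * (ψ.trans (unitConj U⁻¹)) a ∈ C' ↔ X * a ∈ S := by
    rw [← hC, map_mul, RingEquiv.trans_apply, unitConj_apply, inv_inv]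
    simp only [mul_assoc, Units.mul_inv_cancel_left]
  ext y
  obtain ⟨a, rfl⟩ := (ψ.trans (unitConj U⁻¹)).surjective y
  rw [Subring.mem_map_equiv, RingEquiv.symm_apply_apply]
  constructor
  · exact fun h X hX => (hmem a X).1 (h _ ((hC X).2 hX))
  · intro h Y hY
    obtain ⟨Y, rfl⟩ := U.mulRight.surjective Y
    obtain ⟨X, rfl⟩ := ψ.surjective Y
    exact (hmem a X).2 (h X ((hC X).1 hY))

theorem centraliser_eq_map_center (hC : ∀ X, ψ X * U ∈ C' ↔ X ∈ S)
    (hS : ∀ c c', (∀ X ∈ S, c * X = X * c') → c ∈ Subring.center R) :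
    centraliser C' = (Subring.center R).map (ψ : R →+* M) := by
  ext y
  obtain ⟨c, rfl⟩ := ψ.surjective y
  rw [Subring.mem_map_equiv, ψ.symm_apply_apply]
  constructor
  · refine fun h => hS c (ψ.symm (unitConj U (ψ c))) fun X hX => ψ.injective ?_
    have hcomm := Subring.mem_centralizer_iff.1 h _ ((hC X).2 hX)
    rw [map_mul, map_mul, ψ.apply_symm_apply, unitConj_apply, ← mul_assoc, ← mul_assoc, hcomm,
      mul_assoc, mul_assoc, Units.mul_inv, mul_one]
  · refine fun h => Subring.mem_centralizer_iff.2 fun Y _ => ?_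
    obtain ⟨X, rfl⟩ := ψ.surjective Y
    rw [← map_mul, ← map_mul, Subring.mem_center_iff.1 h]

theorem centre_eq_map (hC : ∀ X, ψ X * U ∈ C' ↔ X ∈ S)
    (hS : ∀ c c', (∀ X ∈ S, c * X = X * c') → c ∈ Subring.center R) :
    centre C' = (leftIdealiser S ⊓ Subring.center R).map (ψ : R →+* M) := by
  rw [centre, leftIdealiser_eq_map hC, centraliser_eq_map_center hC hS,
    Subring.map_inf _ _ _ ψ.injective]

theorem unitConj_mul_mem_iff {A B : Mˣ} (hC : ∀ Y, Y ∈ C' ↔ ∃ X ∈ S, Y = A * ψ X * B) (X : R) :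
    (ψ.trans (unitConj A)) X * ↑(A * B) ∈ C' ↔ X ∈ S := by
  have hX : (ψ.trans (unitConj A)) X * ↑(A * B) = A * ψ X * B := by
    rw [RingEquiv.trans_apply, unitConj_apply, Units.val_mul, mul_assoc, Units.inv_mul_cancel_left]
  rw [hX, hC]
  refine ⟨fun ⟨Y, hY, h⟩ => ?_, fun h => ⟨X, h, rfl⟩⟩
  rw [Units.mul_left_inj, Units.mul_right_inj] at h
  rwa [ψ.injective h]

end Transfer

theorem coeff_zero_ne_zero_of_irreducible {K : Type*} [Field K] {F : K[X]} (hF : F.Monic)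
    (hFi : Irreducible F) (hFX : F ≠ X) : F.coeff 0 ≠ 0 := fun h =>
  hFX <| (eq_of_monic_of_associated Polynomial.monic_X hF <|
    Polynomial.irreducible_X.associated_of_dvd hFi (Polynomial.X_dvd_iff.2 h)).symm

theorem norm_mul_pow_ne_one_of_tower {K' K L : Type*} [Field K'] [Field K] [Field L]
    [Algebra K' K] [Algebra K L] [Algebra K' L] [IsScalarTower K' K L] {η : L} {a : K} {d n k : ℕ}
    (hη : Algebra.norm K' η * Algebra.norm K' ((-1 : K) ^ (d * (n - 1)) * a ^ k) ≠ 1)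
    (hd : Even d) : Algebra.norm K η * a ^ k ≠ 1 := by
  refine fun h => hη ?_
  rw [(hd.mul_right _).neg_one_pow, one_mul, ← Algebra.norm_norm (S := K), ← map_mul, h, map_one]

section Main

variable {K L M : Type*} [Field K] [Field L] [Algebra K L] [FiniteDimensional K L] [IsGalois K L]
  [Ring M] {σ : L ≃ₐ[K] L} {F : K[X]} {k d : ℕ} {η : L}

open SkewPoly

theorem mem_fixedSubfield_iff (hη : η ≠ 0) (ρ : L ≃+* L) (b : L) :
    b ∈ fixedSubfield ρ ↔ b * η = η * ρ b := by
  rw [mul_comm b, mul_right_inj' hη]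
  exact eq_comm

theorem mem_fixedSubfield_trans_symm_iff (hη : η ≠ 0) (ρ τ : L ≃+* L) (b : L) :
    b ∈ fixedSubfield (τ.trans ρ.symm) ↔ η * τ b = η * ρ b := by
  rw [mul_right_inj' hη]
  exact ρ.symm_apply_eq

theorem nonempty_ringEquiv_of_equivalent_code (hσ : ∀ τ : L ≃ₐ[K] L, τ ∈ Subgroup.zpowers σ)
    {ρ : L →+* L} (hF : F.Monic) (hFi : Irreducible F) (hF0 : F.coeff 0 ≠ 0)
    (hd : F.natDegree * k = d) (hd2 : 2 ≤ d) (hdN : 2 * d ≤ Module.finrank K L * F.natDegree)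
    (hη : d = 2 → Module.finrank K L = 2 * k → Algebra.norm K η * F.coeff 0 ^ k ≠ 1)
    {ψ : SkewQuot σ F ≃+* M} {A B : Mˣ} {C' : AddSubgroup M}
    (hC : ∀ Y, Y ∈ C' ↔ ∃ X ∈ code σ F k η (ρ : L →+ L), Y = A * ψ X * B) (U V : Subring L)
    (hU : ∀ b, b ∈ U ↔ b * η = η * ρ b) (hV : ∀ b, b ∈ V ↔ η * (σ ^ d) b = η * ρ b) :
    Nonempty (leftIdealiser C' ≃+* U) ∧ Nonempty (rightIdealiser C' ≃+* V) ∧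
      Nonempty (centraliser C' ≃+* Subring.center (SkewQuot σ F)) ∧
      Nonempty (centre C' ≃+* U.comap (algebraMap K L)) := by
  have : Nontrivial (SkewQuot σ F) := nontrivial_skewQuot hF hFi.natDegree_pos
  have : Nontrivial M := ψ.injective.nontrivial
  have hC := unitConj_mul_mem_iff hC
  have hS (c c') (h : ∀ X ∈ code σ F k η (ρ : L →+ L), c * X = X * c') :=
    mem_center_of_forall_mem_code hσ hFi hF0 hd hd2 hdN h
  have hleft := leftIdealiser_code_eq_map hσ hF hF0 hd hd2 hdN hη hU
  have hright := rightIdealiser_code_eq_map hσ hF hF0 hd hd2 hdN hη hV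
  have hcentre := centre_eq_map hC hS
  rw [hleft, map_const_inf_center hσ hF0, Subring.map_map] at hcentre
  exact ⟨nonempty_ringEquiv_of_eq_map (RingHom.injective _)
      (by rw [leftIdealiser_eq_map hC, hleft, Subring.map_map]),
    nonempty_ringEquiv_of_eq_map (RingHom.injective _)
      (by rw [rightIdealiser_eq_map hC, hright, Subring.map_map]),
    nonempty_ringEquiv_of_eq_map (RingEquiv.injective _) (centraliser_eq_map_center hC hS),
    nonempty_ringEquiv_of_eq_map (RingHom.injective _) hcentre⟩

theorem code_zero_eq (ρ ρ' : L →+ L) : code σ F k 0 ρ = code σ F k 0 ρ' := by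
  ext
  simp only [code, zero_mul]

theorem mainTheorem3_general (hσ : ∀ τ : L ≃ₐ[K] L, τ ∈ Subgroup.zpowers σ) (ρ : L ≃+* L)
    (hF : F.Monic) (hFi : Irreducible F) (hFX : F ≠ X) (hk : 2 * k ≤ Module.finrank K L)
    (hd : 1 < F.natDegree * k)
    (hη : F.natDegree * k = 2 → Module.finrank K L = 2 * k →
      Algebra.norm K η * F.coeff 0 ^ k ≠ 1)
    (φ : SkewQuot σ F ≃+* M) (A B : Mˣ) (C' : AddSubgroup M)
    (hC : ∀ Y, Y ∈ C' ↔ ∃ X ∈ code σ F k η (ρ : L →+ L), Y = A * φ X * B) :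
    (η ≠ 0 →
      Nonempty (leftIdealiser C' ≃+* fixedSubfield ρ) ∧
      Nonempty (rightIdealiser C' ≃+*
        fixedSubfield (((σ ^ (F.natDegree * k) : L ≃ₐ[K] L) : L ≃+* L).trans ρ.symm)) ∧
      Nonempty (centraliser C' ≃+* Subring.center (SkewQuot σ F)) ∧
      Nonempty (centre C' ≃+* (fixedSubfield ρ).comap (algebraMap K L))) ∧
    (η = 0 →
      (∀ ρ' : L →+ L, code σ F k 0 (ρ : L →+ L) = code σ F k 0 ρ') ∧
      Nonempty (leftIdealiser C' ≃+* L) ∧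
      Nonempty (rightIdealiser C' ≃+* L) ∧
      Nonempty (centraliser C' ≃+* Subring.center (SkewQuot σ F)) ∧
      Nonempty (centre C' ≃+* K)) := by
  have hF0 := coeff_zero_ne_zero_of_irreducible hF hFi hFX
  have hdN : 2 * (F.natDegree * k) ≤ Module.finrank K L * F.natDegree := by nlinarith
  have hiso := nonempty_ringEquiv_of_equivalent_code (ρ := (ρ : L →+* L)) hσ hF hFi hF0 rfl hd hdN
    hη hC
  refine ⟨fun hη0 => ?_, ?_⟩
  · exact hiso (fixedSubfield ρ).toSubring (fixedSubfield _).toSubring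
      (mem_fixedSubfield_iff hη0 ρ) (mem_fixedSubfield_trans_symm_iff hη0 ρ _)
  · rintro rfl
    obtain ⟨⟨l⟩, ⟨r⟩, c, ⟨z⟩⟩ := hiso ⊤ ⊤ (by simp) (by simp)
    exact ⟨code_zero_eq _, ⟨l.trans Subring.topEquiv⟩, ⟨r.trans Subring.topEquiv⟩, c,
      ⟨z.trans Subring.topEquiv⟩⟩

end Main

end SkewCode

end

theorem mainTheorem3
    {K' K L : Type*} [Field K'] [Field K] [Field L] [Algebra K' K] [Algebra K L] [Algebra K' L]
    [IsScalarTower K' K L] [FiniteDimensional K' K] [FiniteDimensional K L] [IsGalois K L]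
    (σ : L ≃ₐ[K] L) (hσ : ∀ τ : L ≃ₐ[K] L, τ ∈ Subgroup.zpowers σ)
    (ρ : L ≃ₐ[K'] L) (η : L)
    (F : Polynomial K) (hFm : F.Monic) (hFi : Irreducible F) (hFX : F ≠ Polynomial.X)
    (n s k : ℕ) (hn : Module.finrank K L = n) (hs : F.natDegree = s)
    (hk : 2 * k ≤ n) (hsk : 1 < s * k)
    (hη : Algebra.norm K' η *
      Algebra.norm K' ((-1 : K) ^ (s * k * (n - 1)) * F.coeff 0 ^ k) ≠ 1)
    {D : Type*} [DivisionRing D] {m : ℕ}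
    (φ : SkewCode.SkewQuot σ F ≃+* Matrix (Fin m) (Fin m) D)
    (C' : AddSubgroup (Matrix (Fin m) (Fin m) D))
    (hC' : SkewCode.Equivalent
      ((SkewCode.code σ F k η (ρ : L →+ L)).map
        (φ : SkewCode.SkewQuot σ F →+ Matrix (Fin m) (Fin m) D)) C')
    (h1 : (1 : Matrix (Fin m) (Fin m) D) ∈ C') :
    (η ≠ 0 →
      Nonempty (SkewCode.leftIdealiser C' ≃+* SkewCode.fixedSubfield (ρ : L ≃+* L)) ∧
      Nonempty (SkewCode.rightIdealiser C' ≃+*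
        SkewCode.fixedSubfield (((σ ^ (s * k) : L ≃ₐ[K] L) : L ≃+* L).trans (ρ.symm : L ≃+* L))) ∧
      Nonempty (SkewCode.centraliser C' ≃+* Subring.center (SkewCode.SkewQuot σ F)) ∧
      Nonempty (SkewCode.centre C' ≃+*
        (SkewCode.fixedSubfield (ρ : L ≃+* L)).comap (algebraMap K L))) ∧
    (η = 0 →
      (∀ ρ' : L →+ L, SkewCode.code σ F k 0 (ρ : L →+ L) = SkewCode.code σ F k 0 ρ') ∧
      Nonempty (SkewCode.leftIdealiser C' ≃+* L) ∧
      Nonempty (SkewCode.rightIdealiser C' ≃+* L) ∧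
      Nonempty (SkewCode.centraliser C' ≃+* Subring.center (SkewCode.SkewQuot σ F)) ∧
      Nonempty (SkewCode.centre C' ≃+* K)) := by
  subst hn hs
  obtain ⟨A, B, θ, h⟩ := hC'
  refine SkewCode.mainTheorem3_general hσ (ρ : L ≃+* L) hFm hFi hFX hk hsk
    (fun hd _ => SkewCode.norm_mul_pow_ne_one_of_tower hη (hd ▸ even_two)) (φ.trans θ.mapMatrix)
    A B C' fun Y => ?_
  rw [← SetLike.mem_coe, h]
  simp only [Set.mem_ofPred_eq, AddSubgroup.mem_map, exists_exists_and_eq_and]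
  rfl
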